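/- Let $\kappa>0$ and $c>2\kappa$, and let $Q$ be a solitary wave profile with speed $c$ of the Camassa--Holm equation $$(1-\partial_x^2)u_t+3uu_x+2\kappa u_x-2u_xu_{xx}-uu_{xxx}=0,$$ that is, $Q\colon\mathbb{R}\to\mathbb{R}$ is $C^3$, not identically zero, $Q(x)\to 0$ as $|x|\to\infty$, and $u(t,x)=Q(x-ct)$ solves the equation. Let $$M=\partial_x(Q-c)\partial_x+Q''-3Q+c-2\kappa,\qquad L=-\partial_xM\partial_x,$$ where derivatives are taken in the sense of distributions. Then $L\psi\in L^2(\mathbb{R})$ for every $\psi\in H^4(\mathbb{R})$, and the operator $L\colon H^4(\mathbb{R})\subset L^2(\mathbb{R})\to L^2(\mathbb{R})$, with domain $H^4(\mathbb{R})$ in the complex Hilbert space $L^2(\mathbb{R})$, is self-adjoint; in particular $\operatorname{dom}(L^*)=H^4(\mathbb{R})$. -/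

import Mathlib

open MeasureTheory Filter Topology TemperedDistribution
open scoped SchwartzMap ENNReal

namespace CHKP

noncomputable section

/-- The Camassa--Holm equation
`(1 - ∂ₓ²) uₜ + 3 u uₓ + 2 κ uₓ - 2 uₓ uₓₓ - u uₓₓₓ = 0` for `u = u(t, x)`, pointwise; used for
three times continuously differentiable `u`. -/
def SolvesCH (κ : ℝ) (u : ℝ → ℝ → ℝ) : Prop :=
  ∀ t x : ℝ,
    deriv (fun s => u s x) t - iteratedDeriv 2 (fun y => deriv (fun s => u s y) t) x
      + 3 * u t x * deriv (u t) x + 2 * κ * deriv (u t) x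
      - 2 * deriv (u t) x * iteratedDeriv 2 (u t) x
      - u t x * iteratedDeriv 3 (u t) x = 0

/-- `Q` is the profile of a solitary wave of the Camassa--Holm equation with speed `c`: a nonzero
classical solution of the form `u(t, x) = Q(x - c t)` whose profile decays to zero at infinity. -/
structure IsSolitaryWave (κ c : ℝ) (Q : ℝ → ℝ) : Prop where
  contDiff : ContDiff ℝ 3 Q
  ne_zero : Q ≠ 0
  tendsto_zero : Tendsto Q (cocompact ℝ) (𝓝 0)
  solves : SolvesCH κ (fun t x => Q (x - c * t))

/-- The Hilbert space `L²(ℝ)` of complex-valued functions. -/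
abbrev L2 : Type := Lp ℂ 2 (volume : Measure ℝ)

/-- The embedding of `L²(ℝ)` into the tempered distributions. -/
def toDist : L2 →ₗ[ℂ] 𝓢'(ℝ, ℂ) :=
  (Lp.toTemperedDistributionCLM ℂ (volume : Measure ℝ) 2).toLinearMap

theorem toDist_apply (f : L2) : toDist f = (f : 𝓢'(ℝ, ℂ)) := rfl

theorem toDist_injective : Function.Injective toDist :=
  LinearMap.ker_eq_bot.mp Lp.ker_toTemperedDistributionCLM_eq_bot

/-- The Sobolev space `H⁴(ℝ)` as a subspace of `L²(ℝ)`. -/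
def H4 : Submodule ℂ L2 where
  carrier := {f | MemSobolev 4 2 (toDist f)}
  add_mem' hf hg := by simpa using hf.add hg
  zero_mem' := by simp
  smul_mem' a f hf := by simpa using hf.smul a

/-- `M = ∂ₓ (Q - c) ∂ₓ + Q'' - 3 Q + c - 2 κ`, acting on tempered distributions. Here
`smulLeftCLM ℂ g` is multiplication by `g`; it is meaningful for `g` smooth with derivatives of
polynomial growth, which the coefficients are when `Q` is a solitary wave and `0 < κ`, `2 κ < c`
(then `Q` is smooth with bounded derivatives). -/
def distM (κ c : ℝ) (Q : ℝ → ℝ) : 𝓢'(ℝ, ℂ) →L[ℂ] 𝓢'(ℝ, ℂ) :=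
  derivCLM ℂ ∘L smulLeftCLM ℂ (fun x => ((Q x - c : ℝ) : ℂ)) ∘L derivCLM ℂ
    + smulLeftCLM ℂ (fun x => ((iteratedDeriv 2 Q x - 3 * Q x + c - 2 * κ : ℝ) : ℂ))

/-- `L = -∂ₓ M ∂ₓ`, acting on tempered distributions. -/
def distL (κ c : ℝ) (Q : ℝ → ℝ) : 𝓢'(ℝ, ℂ) →L[ℂ] 𝓢'(ℝ, ℂ) :=
  -(derivCLM ℂ ∘L distM κ c Q ∘L derivCLM ℂ)

/-- The operator `L = -∂ₓ M ∂ₓ` in `L²(ℝ)`: it is defined at those `ψ ∈ H⁴(ℝ)` for which the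
distribution `-∂ₓ M ∂ₓ ψ` is (represented by) an element of `L²(ℝ)`, and that element is
its value. -/
def opL (κ c : ℝ) (Q : ℝ → ℝ) : L2 →ₗ.[ℂ] L2 where
  domain := H4 ⊓ (LinearMap.range toDist).comap ((distL κ c Q).toLinearMap ∘ₗ toDist)
  toFun := (LinearEquiv.ofInjective toDist toDist_injective).symm.toLinearMap ∘ₗ
    (((distL κ c Q).toLinearMap ∘ₗ toDist).restrict fun _ hψ => (Submodule.mem_inf.mp hψ).2)

theorem mem_H4_iff (f : L2) : f ∈ H4 ↔ MemSobolev 4 2 (f : 𝓢'(ℝ, ℂ)) := Iff.rfl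

theorem mem_opL_domain_iff (κ c : ℝ) (Q : ℝ → ℝ) (ψ : L2) :
    ψ ∈ (opL κ c Q).domain ↔
      ψ ∈ H4 ∧ ∃ g : L2, (g : 𝓢'(ℝ, ℂ)) = distL κ c Q (ψ : 𝓢'(ℝ, ℂ)) := Iff.rfl

theorem opL_apply (κ c : ℝ) (Q : ℝ → ℝ) (ψ : (opL κ c Q).domain) :
    ((opL κ c Q ψ : L2) : 𝓢'(ℝ, ℂ)) = distL κ c Q ((ψ : L2) : 𝓢'(ℝ, ℂ)) :=
  congrArg Subtype.val ((LinearEquiv.ofInjective toDist toDist_injective).apply_symm_apply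
    (((distL κ c Q).toLinearMap ∘ₗ toDist).restrict
      (fun _ hψ => (Submodule.mem_inf.mp hψ).2) ψ))

end

end CHKP

/-! In conservation form, `L f = -((Q - c) f'')'' - (V f')'` with `V = Q'' - 3 Q + c - 2 κ`. This is
a formally symmetric fourth-order operator with real coefficients, so self-adjointness follows once
it is uniformly elliptic with smooth bounded coefficients.

Both properties come from the profile equation. Two integrations and decay give `(c - Q) Q'' = (c -
2 κ) Q - 3/2 Q² + 1/2 Q'²` and `(c - Q) Q'² = (c - 2 κ) Q² - Q³` (`first_integrals`). The second
identity rules out `Q = c`; hence `1 / (c - Q)` is bounded, and the algebra generated by `Q`, `Q'`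
and `1 / (c - Q)` consists of bounded functions and is closed under differentiation.

Integration by parts on `H⁴` shows that `L` is contained in its adjoint (`opL_isFormalAdjoint`).
Conversely, if `y` lies in the domain of the adjoint, testing against Schwartz functions shows that
the distribution `L y` is in `L²`, and elliptic regularity (`memSobolev_four_of_elliptic`) puts `y`
in `H⁴`. -/

open scoped ContDiff LineDeriv Laplacian FourierTransform

namespace CHKP

/-! ### Smooth functions with bounded derivatives, and calculus lemmas -/

/-- Smooth real functions all of whose derivatives are bounded. -/
structure IsBddSmooth (g : ℝ → ℝ) : Prop where
  contDiff : ContDiff ℝ ∞ g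
  bounded : ∀ n, ∃ C, ∀ x, |iteratedDeriv n g x| ≤ C

namespace IsBddSmooth

variable {f g : ℝ → ℝ}

theorem deriv (hg : IsBddSmooth g) : IsBddSmooth (deriv g) where
  contDiff := ((contDiff_infty_iff_deriv (𝕜 := ℝ)).1 hg.contDiff).2
  bounded n := by
    simpa only [iteratedDeriv_succ'] using hg.bounded (n + 1)

theorem exists_bound (hg : IsBddSmooth g) : ∃ C, ∀ x, |g x| ≤ C := by
  simpa using hg.bounded 0

theorem hasDerivAt (hg : IsBddSmooth g) (x : ℝ) : HasDerivAt g (_root_.deriv g x) x :=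
  (hg.contDiff.differentiable (by simp) x).hasDerivAt

theorem hasTemperateGrowth (hg : IsBddSmooth g) : g.HasTemperateGrowth := by
  refine ⟨hg.contDiff, fun n => ?_⟩
  obtain ⟨C, hC⟩ := hg.bounded n
  exact ⟨0, C, fun x => by simpa [norm_iteratedFDeriv_eq_norm_iteratedDeriv] using hC x⟩

theorem hasTemperateGrowth_ofReal (hg : IsBddSmooth g) :
    (fun x => (g x : ℂ)).HasTemperateGrowth :=
  Function.HasTemperateGrowth.comp Function.Complex.hasTemperateGrowth_ofReal hg.hasTemperateGrowth

/-- A subalgebra of bounded differentiable functions that is closed under differentiation consists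
of smooth functions with bounded derivatives. -/
theorem of_mem_subalgebra (S : Subalgebra ℝ (ℝ → ℝ))
    (hS : ∀ f ∈ S, Differentiable ℝ f ∧ (∃ C, ∀ x, |f x| ≤ C) ∧ _root_.deriv f ∈ S) (hg : g ∈ S) :
    IsBddSmooth g := by
  have key (n : ℕ) : iteratedDeriv n g ∈ S := by
    induction n with
    | zero => simpa using hg
    | succ n ih => rw [iteratedDeriv_succ]; exact (hS _ ih).2.2
  exact ⟨contDiff_of_differentiable_iteratedDeriv fun n _ => (hS _ (key n)).1,
    fun n => (hS _ (key n)).2.1⟩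

end IsBddSmooth

/-- The condition that makes `Algebra.adjoin` closed under differentiation can be checked on
generators. -/
theorem adjoin_bounded_deriv_mem (s : Set (ℝ → ℝ))
    (hs : ∀ f ∈ s, Differentiable ℝ f ∧ (∃ C, ∀ x, |f x| ≤ C) ∧ deriv f ∈ Algebra.adjoin ℝ s) :
    ∀ f ∈ Algebra.adjoin ℝ s,
      Differentiable ℝ f ∧ (∃ C, ∀ x, |f x| ≤ C) ∧ deriv f ∈ Algebra.adjoin ℝ s := by
  intro f hf
  induction hf using Algebra.adjoin_induction with
  | mem f hf => exact hs f hf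
  | algebraMap a =>
    refine ⟨differentiable_const a, ⟨|a|, fun x => le_rfl⟩, ?_⟩
    have : deriv (algebraMap ℝ (ℝ → ℝ) a) = 0 := by
      ext x; exact deriv_const x a
    rw [this]
    exact zero_mem _
  | add f g _ _ hf hg =>
    obtain ⟨hf1, ⟨C, hC⟩, hf3⟩ := hf
    obtain ⟨hg1, ⟨D, hD⟩, hg3⟩ := hg
    refine ⟨hf1.add hg1, ⟨C + D, fun x => (abs_add_le _ _).trans (add_le_add (hC x) (hD x))⟩, ?_⟩
    have : deriv (f + g) = deriv f + deriv g := by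
      ext x; exact deriv_add (hf1 x) (hg1 x)
    rw [this]
    exact add_mem hf3 hg3
  | mul f g hf' hg' hf hg =>
    obtain ⟨hf1, ⟨C, hC⟩, hf3⟩ := hf
    obtain ⟨hg1, ⟨D, hD⟩, hg3⟩ := hg
    refine ⟨hf1.mul hg1, ⟨C * D, fun x => ?_⟩, ?_⟩
    · rw [Pi.mul_apply, abs_mul]
      exact mul_le_mul (hC x) (hD x) (abs_nonneg _) ((abs_nonneg _).trans (hC x))
    have : deriv (f * g) = deriv f * g + f * deriv g := by
      ext x; exact deriv_mul (hf1 x) (hg1 x)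
    rw [this]
    exact add_mem (mul_mem hf3 hg') (mul_mem hf' hg3)

/-- A differentiable function with limit zero at infinity has small derivative somewhere far out. -/
theorem exists_seq_tendsto_deriv_zero {f f' : ℝ → ℝ} (hf : ∀ x, HasDerivAt f (f' x) x)
    (h0 : Tendsto f atTop (𝓝 0)) :
    ∃ ξ : ℕ → ℝ, Tendsto ξ atTop atTop ∧ Tendsto (fun n => f' (ξ n)) atTop (𝓝 0) := by
  have hmv (n : ℕ) : ∃ y : ℝ, (n : ℝ) < y ∧ f' y = f (n + 1) - f n := by
    obtain ⟨y, hy, h⟩ := exists_hasDerivAt_eq_slope f f' (lt_add_one (n : ℝ))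
      (fun x _ => (hf x).continuousAt.continuousWithinAt) (fun x _ => hf x)
    exact ⟨y, hy.1, by simpa using h⟩
  choose ξ hξ hξ' using hmv
  refine ⟨ξ, tendsto_atTop_mono (fun n => (hξ n).le) tendsto_natCast_atTop_atTop, ?_⟩
  simp_rw [hξ']
  have h1 : Tendsto (fun n : ℕ => f ((n : ℝ) + 1)) atTop (𝓝 0) :=
    h0.comp (tendsto_atTop_add_const_right _ _ tendsto_natCast_atTop_atTop)
  simpa using h1.sub (h0.comp tendsto_natCast_atTop_atTop)

theorem exists_bound_of_tendsto_cocompact {f : ℝ → ℝ} {l : ℝ} (hf : Continuous f)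
    (hl : Tendsto f (cocompact ℝ) (𝓝 l)) : ∃ C, ∀ x, |f x| ≤ C := by
  let g : ZeroAtInftyContinuousMap ℝ ℝ :=
    ⟨⟨fun x => f x - l, by fun_prop⟩, by simpa using hl.sub_const l⟩
  obtain ⟨C, hC⟩ := ZeroAtInftyContinuousMap.bounded g
  obtain ⟨D, hD⟩ : ∃ D, ∀ x, dist (g x) 0 ≤ D :=
    ⟨C + dist (g 0) 0, fun x => (dist_triangle _ (g 0) _).trans (by gcongr; exact hC x 0)⟩
  refine ⟨D + |l|, fun x => ?_⟩
  have : |f x - l| ≤ D := by simpa [g] using hD x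
  calc |f x| = |(f x - l) + l| := by ring_nf
    _ ≤ _ := (abs_add_le _ _).trans (by gcongr)

theorem eq_of_hasDerivAt_zero {f : ℝ → ℝ} (hf : ∀ x, HasDerivAt f 0 x) (x y : ℝ) : f x = f y :=
  is_const_of_deriv_eq_zero (fun x => (hf x).differentiableAt) (fun x => (hf x).deriv) x y

/-! ### The solitary wave profile: first integrals and regularity -/

namespace IsSolitaryWave

variable {κ c : ℝ} {Q : ℝ → ℝ}

theorem hasDerivAt (hQ : IsSolitaryWave κ c Q) (x : ℝ) : HasDerivAt Q (deriv Q x) x :=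
  (hQ.contDiff.differentiable (by simp) x).hasDerivAt

theorem hasDerivAt_deriv (hQ : IsSolitaryWave κ c Q) (x : ℝ) :
    HasDerivAt (deriv Q) (deriv (deriv Q) x) x := by
  have h := hQ.contDiff.differentiable_iteratedDeriv 1 (by norm_num)
  rw [iteratedDeriv_one] at h
  exact (h x).hasDerivAt

theorem hasDerivAt_deriv_deriv (hQ : IsSolitaryWave κ c Q) (x : ℝ) :
    HasDerivAt (deriv (deriv Q)) (deriv (deriv (deriv Q)) x) x := by
  have h := hQ.contDiff.differentiable_iteratedDeriv 2 (by norm_num)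
  rw [iteratedDeriv_succ, iteratedDeriv_one] at h
  exact (h x).hasDerivAt

/-- The equation is read at time `0`, where `∂ₜ` acts as `-c ∂ₓ`; the third-order terms `c Q'''` and
`-Q Q'''` then combine. -/
theorem ode (hQ : IsSolitaryWave κ c Q) (x : ℝ) :
    (c - Q x) * deriv (deriv (deriv Q)) x =
      (c - 2 * κ) * deriv Q x - 3 * Q x * deriv Q x + 2 * deriv Q x * deriv (deriv Q) x := by
  have ht (y : ℝ) : deriv (fun s => Q (y - c * s)) 0 = -c * deriv Q y := by
    have h1 : HasDerivAt (fun s : ℝ => y - c * s) (-c) 0 := by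
      simpa using ((hasDerivAt_id (0 : ℝ)).const_mul c).const_sub y
    have h2 : HasDerivAt Q (deriv Q y) (y - c * 0) := by simpa using hQ.hasDerivAt y
    refine (h2.comp (0 : ℝ) h1).deriv.trans ?_
    ring
  have h := hQ.solves 0 x
  have e2 (f : ℝ → ℝ) : iteratedDeriv 2 f = deriv (deriv f) := by
    rw [iteratedDeriv_succ, iteratedDeriv_one]
  have e3 : iteratedDeriv 3 Q = deriv (deriv (deriv Q)) := by
    rw [iteratedDeriv_succ, e2]
  have e4 : deriv (deriv fun y => -c * deriv Q y) x = -c * deriv (deriv (deriv Q)) x := by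
    have : deriv (fun y => -c * deriv Q y) = fun y => -c * deriv (deriv Q) y := by
      ext y; exact ((hQ.hasDerivAt_deriv y).const_mul (-c)).deriv
    rw [this]
    exact ((hQ.hasDerivAt_deriv_deriv x).const_mul (-c)).deriv
  simp only [ht, e2, e4, mul_zero, sub_zero, e3] at h
  linarith

theorem tendsto_atTop (hQ : IsSolitaryWave κ c Q) : Tendsto Q atTop (𝓝 0) :=
  hQ.tendsto_zero.mono_left atTop_le_cocompact

/-- The two first integrals of the profile equation. -/
theorem first_integrals (hQ : IsSolitaryWave κ c Q) (hc0 : 0 < c) (x : ℝ) :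
    (c - Q x) * deriv (deriv Q) x =
        (c - 2 * κ) * Q x - 3 / 2 * Q x ^ 2 + 1 / 2 * deriv Q x ^ 2 ∧
      (c - Q x) * deriv Q x ^ 2 = (c - 2 * κ) * Q x ^ 2 - Q x ^ 3 := by
  set E : ℝ → ℝ := fun x => (c - Q x) * deriv (deriv Q) x -
    ((c - 2 * κ) * Q x - 3 / 2 * Q x ^ 2 + 1 / 2 * deriv Q x ^ 2) with hE
  have hE' (x : ℝ) : HasDerivAt E 0 x := by
    have h0 := hQ.hasDerivAt x
    have h1 := hQ.hasDerivAt_deriv x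
    have h2 := hQ.hasDerivAt_deriv_deriv x
    refine (((h0.const_sub c).mul h2).sub (((h0.const_mul (c - 2 * κ)).sub
      ((h0.pow 2).const_mul (3 / 2))).add ((h1.pow 2).const_mul (1 / 2)))).congr_deriv ?_
    linear_combination hQ.ode x
  obtain ⟨A, hA⟩ : ∃ A, ∀ x, E x = A := ⟨E 0, fun x => eq_of_hasDerivAt_zero hE' _ _⟩
  -- Obtained by multiplying `E = A` by `2 Q'` and integrating.
  set G : ℝ → ℝ := fun x => (c - Q x) * deriv Q x ^ 2 -
    ((c - 2 * κ) * Q x ^ 2 - Q x ^ 3 + 2 * A * Q x) with hG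
  have hG' (x : ℝ) : HasDerivAt G 0 x := by
    have h0 := hQ.hasDerivAt x
    have h1 := hQ.hasDerivAt_deriv x
    refine (((h0.const_sub c).mul (h1.pow 2)).sub ((((h0.pow 2).const_mul (c - 2 * κ)).sub
      (h0.pow 3)).add (h0.const_mul (2 * A)))).congr_deriv ?_
    have := hA x
    simp only [hE] at this
    norm_num
    linear_combination 2 * deriv Q x * this
  obtain ⟨B, hB⟩ : ∃ B, ∀ x, G x = B := ⟨G 0, fun x => eq_of_hasDerivAt_zero hG' _ _⟩
  have hlim := hQ.tendsto_atTop
  -- `B` has to be treated before `A`: a sequence along which `Q'` tends to `0` suffices here,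
  -- whereas `A = 0` needs `Q' → 0` along a sequence chosen to make `Q''` small. The full limit of
  -- `Q'` comes from `B = 0`.
  have hB0 : B = 0 := by
    obtain ⟨ξ, hξ, hξ'⟩ := exists_seq_tendsto_deriv_zero hQ.hasDerivAt hlim
    have hq := hlim.comp hξ
    have h : Tendsto (fun n => G (ξ n)) atTop (𝓝 ((c - 0) * 0 ^ 2 -
        ((c - 2 * κ) * 0 ^ 2 - 0 ^ 3 + 2 * A * 0))) :=
      ((hq.const_sub c).mul (hξ'.pow 2)).sub
        ((((hq.pow 2).const_mul _).sub (hq.pow 3)).add (hq.const_mul _))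
    simp only [hB] at h
    simpa using tendsto_nhds_unique tendsto_const_nhds h
  have hd : Tendsto (deriv Q) atTop (𝓝 0) := by
    have hsq : Tendsto (fun x => deriv Q x ^ 2) atTop (𝓝 0) := by
      have h : Tendsto (fun x => ((c - 2 * κ) * Q x ^ 2 - Q x ^ 3 + 2 * A * Q x) / (c - Q x)) atTop
          (𝓝 (((c - 2 * κ) * 0 ^ 2 - 0 ^ 3 + 2 * A * 0) / (c - 0))) :=
        ((((hlim.pow 2).const_mul _).sub (hlim.pow 3)).add (hlim.const_mul _)).div
          (hlim.const_sub c) (by simpa using hc0.ne')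
      simp only [ne_eq, OfNat.ofNat_ne_zero, not_false_eq_true, zero_pow, mul_zero, sub_zero,
        add_zero, zero_div] at h
      refine h.congr' ?_
      filter_upwards [hlim.eventually_lt_const hc0] with x hx
      have := hB x
      simp only [hG, hB0] at this
      rw [div_eq_iff (by linarith)]
      linarith
    have := hsq.sqrt
    simp only [Real.sqrt_sq_eq_abs, Real.sqrt_zero] at this
    exact (tendsto_zero_iff_abs_tendsto_zero _).2 this
  have hA0 : A = 0 := by
    obtain ⟨ξ, hξ, hξ'⟩ := exists_seq_tendsto_deriv_zero hQ.hasDerivAt_deriv hd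
    have hq := hlim.comp hξ
    have hq' := hd.comp hξ
    have h : Tendsto (fun n => E (ξ n)) atTop (𝓝 ((c - 0) * 0 -
        ((c - 2 * κ) * 0 - 3 / 2 * 0 ^ 2 + 1 / 2 * 0 ^ 2))) :=
      ((hq.const_sub c).mul hξ').sub
        (((hq.const_mul _).sub ((hq.pow 2).const_mul _)).add ((hq'.pow 2).const_mul _))
    simp only [hA] at h
    simpa using tendsto_nhds_unique tendsto_const_nhds h
  have h1 := hA x
  have h2 := hB x
  simp only [hE, hG, hA0, hB0] at h1 h2
  constructor <;> linarith

theorem lt_speed (hQ : IsSolitaryWave κ c Q) (hκ : 0 < κ) (hc0 : 0 < c) (x : ℝ) : Q x < c := by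
  by_contra! hx
  obtain ⟨y, hy⟩ := (hQ.tendsto_atTop.eventually_lt_const hc0).exists
  obtain ⟨z, hz⟩ := mem_range_of_exists_le_of_exists_ge hQ.contDiff.continuous
    ⟨y, hy.le⟩ ⟨x, hx⟩
  -- At a point where `Q = c` the second integral reads `0 = -2 κ c²`.
  have h := (hQ.first_integrals hc0 z).2
  rw [hz] at h
  have : 0 < κ * c ^ 2 := by positivity
  nlinarith

/-- The profile of a solitary wave, its second derivative and `1 / (c - Q)` lie in a common
subalgebra of smooth functions with bounded derivatives. -/
theorem exists_subalgebra_isBddSmooth (hQ : IsSolitaryWave κ c Q) (hκ : 0 < κ) (hc0 : 0 < c) :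
    ∃ S : Subalgebra ℝ (ℝ → ℝ), (∀ f ∈ S, IsBddSmooth f) ∧ Q ∈ S ∧ deriv (deriv Q) ∈ S ∧
      (fun x => (c - Q x)⁻¹) ∈ S := by
  set r : ℝ → ℝ := fun x => (c - Q x)⁻¹ with hr
  have hpos (x : ℝ) : c - Q x ≠ 0 := (sub_pos.2 (hQ.lt_speed hκ hc0 x)).ne'
  have hrd (x : ℝ) : HasDerivAt r (deriv Q x * r x ^ 2) x :=
    (((hQ.hasDerivAt x).const_sub c).inv (hpos x)).congr_deriv (by simp [hr, div_eq_mul_inv])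
  obtain ⟨C, hC⟩ := exists_bound_of_tendsto_cocompact hQ.contDiff.continuous hQ.tendsto_zero
  obtain ⟨D, hD⟩ : ∃ D, ∀ x, |r x| ≤ D :=
    exists_bound_of_tendsto_cocompact
      (continuous_iff_continuousAt.2 fun x => (hrd x).continuousAt)
      ((hQ.tendsto_zero.const_sub c).inv₀ (by simpa using hc0.ne'))
  have hQ1 (x : ℝ) : deriv Q x ^ 2 = r x * ((c - 2 * κ) * Q x ^ 2 - Q x ^ 3) := by
    rw [← (hQ.first_integrals hc0 x).2, ← mul_assoc, inv_mul_cancel₀ (hpos x), one_mul]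
  have hQ2 (x : ℝ) : deriv (deriv Q) x =
      r x * ((c - 2 * κ) * Q x - 3 / 2 * Q x ^ 2 + 1 / 2 * deriv Q x ^ 2) := by
    rw [← (hQ.first_integrals hc0 x).1, ← mul_assoc, inv_mul_cancel₀ (hpos x), one_mul]
  have hQ1b : ∃ K, ∀ x, |deriv Q x| ≤ K := by
    refine ⟨√(D * (|c - 2 * κ| * C ^ 2 + C ^ 3)), fun x => Real.abs_le_sqrt ?_⟩
    rw [hQ1]
    refine (le_abs_self _).trans ?_
    rw [abs_mul]
    have hC0 : 0 ≤ C := (abs_nonneg _).trans (hC x)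
    have hD0 : 0 ≤ D := (abs_nonneg _).trans (hD x)
    refine mul_le_mul (hD x) ?_ (abs_nonneg _) hD0
    refine (abs_sub _ _).trans ?_
    rw [abs_mul, abs_pow, abs_pow]
    have := hC x
    gcongr
  -- `Q'` must be a generator, since the first integrals determine only its square; the system
  -- closes through `r' = Q' r²` and the formula for `Q''`.
  set s : Set (ℝ → ℝ) := {Q, deriv Q, r} with hs
  have m0 : Q ∈ Algebra.adjoin ℝ s := Algebra.subset_adjoin (by simp [hs])
  have m1 : deriv Q ∈ Algebra.adjoin ℝ s := Algebra.subset_adjoin (by simp [hs])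
  have mr : r ∈ Algebra.adjoin ℝ s := Algebra.subset_adjoin (by simp [hs])
  have m2 : deriv (deriv Q) ∈ Algebra.adjoin ℝ s := by
    have : deriv (deriv Q) =
        r * ((c - 2 * κ) • Q - (3 / 2 : ℝ) • Q ^ 2 + (1 / 2 : ℝ) • deriv Q ^ 2) := by
      ext x; simp [hQ2 x]
    rw [this]
    exact mul_mem mr (add_mem (sub_mem (Subalgebra.smul_mem _ m0 _)
      (Subalgebra.smul_mem _ (pow_mem m0 2) _)) (Subalgebra.smul_mem _ (pow_mem m1 2) _))
  have hgen := adjoin_bounded_deriv_mem s (by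
    rintro f (rfl | rfl | rfl)
    · exact ⟨fun x => (hQ.hasDerivAt x).differentiableAt, ⟨C, hC⟩, m1⟩
    · exact ⟨fun x => (hQ.hasDerivAt_deriv x).differentiableAt, hQ1b, m2⟩
    · refine ⟨fun x => (hrd x).differentiableAt, ⟨D, hD⟩, ?_⟩
      have : deriv r = deriv Q * r ^ 2 := by ext x; exact (hrd x).deriv
      rw [this]
      exact mul_mem m1 (pow_mem mr 2))
  exact ⟨Algebra.adjoin ℝ s, fun f hf => IsBddSmooth.of_mem_subalgebra _ hgen hf, m0, m2, mr⟩

/-- The coefficients of the linearised operator are smooth with bounded derivatives, and the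
leading one is bounded away from zero. -/
theorem isBddSmooth_coefficients (hQ : IsSolitaryWave κ c Q) (hκ : 0 < κ) (hc0 : 0 < c) :
    IsBddSmooth (fun x => Q x - c) ∧ IsBddSmooth (fun x => (Q x - c)⁻¹) ∧
      IsBddSmooth (fun x => iteratedDeriv 2 Q x - 3 * Q x + c - 2 * κ) := by
  obtain ⟨S, hS, m0, m2, mr⟩ := hQ.exists_subalgebra_isBddSmooth hκ hc0
  have hconst (a : ℝ) : (fun _ => a) ∈ S := S.algebraMap_mem a
  refine ⟨hS _ (sub_mem m0 (hconst c)), hS _ ?_, hS _ ?_⟩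
  · convert neg_mem mr using 1
    ext x
    simp [← inv_neg]
  · rw [iteratedDeriv_succ, iteratedDeriv_one]
    exact sub_mem (add_mem (sub_mem m2 (mul_mem (hconst 3) m0)) (hconst c)) (hconst (2 * κ))

end IsSolitaryWave

/-! ### Derivatives, multiplication and Sobolev regularity of distributions -/

theorem schwartz_lineDerivOp_one (u : 𝓢(ℝ, ℂ)) : ∂_{(1 : ℝ)} u = SchwartzMap.derivCLM ℂ ℂ u := by
  ext x
  simp [SchwartzMap.lineDerivOp_apply_eq_fderiv]

theorem lineDerivOp_one_eq_derivCLM (f : 𝓢'(ℝ, ℂ)) : ∂_{(1 : ℝ)} f = derivCLM ℂ f := by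
  ext u
  simp [schwartz_lineDerivOp_one]

theorem laplacian_eq_derivCLM_derivCLM (f : 𝓢'(ℝ, ℂ)) : Δ f = derivCLM ℂ (derivCLM ℂ f) := by
  rw [laplacian_eq_sum (OrthonormalBasis.singleton Unit ℝ)]
  simp [lineDerivOp_one_eq_derivCLM]

theorem memSobolev_derivCLM {s t : ℝ} (hst : t + 1 = s) {f : 𝓢'(ℝ, ℂ)} (hf : MemSobolev s 2 f) :
    MemSobolev t 2 (derivCLM ℂ f) := by
  rw [← lineDerivOp_one_eq_derivCLM, show t = s - 1 by linarith]
  exact hf.lineDerivOp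

theorem memSobolev_zero_toDist (f : L2) : MemSobolev 0 2 (toDist f) :=
  memSobolev_zero_iff.2 ⟨f, rfl⟩

/-- The Bessel potential of order `2` has symbol `1 + |ξ|²`, so it equals `f - (2π)⁻² f''`. -/
theorem memSobolev_of_derivCLM_derivCLM {s t : ℝ} (hst : t + 2 = s) {f : 𝓢'(ℝ, ℂ)}
    (hf : MemSobolev t 2 f) (hf2 : MemSobolev t 2 (derivCLM ℂ (derivCLM ℂ f))) :
    MemSobolev s 2 f := by
  rw [show s = 2 + t by linarith, ← memSobolev_besselPotential_iff]
  have key : besselPotential ℝ ℂ 2 f =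
      f - ((((2 * Real.pi) ^ 2)⁻¹ : ℝ) : ℂ) • derivCLM ℂ (derivCLM ℂ f) := by
    rw [← laplacian_eq_derivCLM_derivCLM, laplacian_eq_fourierMultiplierCLM, besselPotential]
    have h1 : fourierMultiplierCLM ℂ (fun x : ℝ => (((1 + ‖x‖ ^ 2) ^ ((2 : ℝ) / 2) : ℝ) : ℂ)) f =
        f + fourierMultiplierCLM ℂ (fun x : ℝ => ((‖x‖ ^ 2 : ℝ) : ℂ)) f := by
      have h2 : (fun x : ℝ => (((1 + ‖x‖ ^ 2) ^ ((2 : ℝ) / 2) : ℝ) : ℂ)) =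
          (fun _ => (1 : ℂ)) + fun x : ℝ => ((‖x‖ ^ 2 : ℝ) : ℂ) := by
        ext x; simp
      rw [h2, fourierMultiplierCLM_apply, smulLeftCLM_add (by fun_prop) (by fun_prop)]
      simp [fourierMultiplierCLM_apply, FourierTransform.fourierInv_add]
    rw [h1]
    ext u
    simp only [add_apply, smul_apply, neg_smul, smul_neg, sub_neg_eq_add,
      Complex.coe_smul, smul_smul]
    rw [inv_mul_cancel₀ (by positivity), one_smul]
  rw [key]
  exact hf.sub (hf2.smul _)

theorem derivCLM_smulLeftCLM {g g' : ℝ → ℂ} (hg : g.HasTemperateGrowth)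
    (hg' : g'.HasTemperateGrowth) (h : ∀ x, HasDerivAt g (g' x) x) (f : 𝓢'(ℝ, ℂ)) :
    derivCLM ℂ (smulLeftCLM ℂ g f) = smulLeftCLM ℂ g' f + smulLeftCLM ℂ g (derivCLM ℂ f) := by
  ext u
  have key : -SchwartzMap.smulLeftCLM ℂ g (SchwartzMap.derivCLM ℂ ℂ u) =
      SchwartzMap.smulLeftCLM ℂ g' u -
        SchwartzMap.derivCLM ℂ ℂ (SchwartzMap.smulLeftCLM ℂ g u) := by
    ext x
    have hd : deriv (SchwartzMap.smulLeftCLM ℂ g u) x = g' x * u x + g x * deriv u x := by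
      rw [SchwartzMap.smulLeftCLM_apply hg]
      exact ((h x).mul (u.hasDerivAt x)).deriv
    simp [hg, hg', hd]
  simpa [sub_eq_add_neg] using congrArg f key

/-- Compactly supported smooth functions are Schwartz, and they separate locally integrable
functions. -/
theorem ae_eq_mul_of_toDist_eq {g : ℝ → ℂ} (hg : g.HasTemperateGrowth) {f h : L2}
    (hfh : toDist h = smulLeftCLM ℂ g (toDist f)) : h =ᵐ[volume] fun x => g x * f x := by
  refine ae_eq_of_integral_contDiff_smul_eq ((Lp.memLp h).locallyIntegrable (by norm_num)) ?_ ?_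
  · have := (((Lp.memLp f).locallyIntegrable (by norm_num)).locallyIntegrableOn Set.univ).continuousOn_mul
      hg.1.continuous.continuousOn isOpen_univ.isLocallyClosed
    exact locallyIntegrableOn_univ.1 this
  · intro u hu hc
    have hg₁ : HasCompactSupport (Complex.ofRealCLM ∘ u) := hc.comp_left rfl
    have hg₂ : ContDiff ℝ ∞ (Complex.ofRealCLM ∘ u) := by fun_prop
    have := DFunLike.congr_fun hfh (hg₁.toSchwartzMap hg₂)
    simpa [toDist_apply, hg, mul_assoc, mul_left_comm] using this

theorem exists_toDist_eq_smulLeftCLM {g : ℝ → ℝ} (hg : IsBddSmooth g) (f : L2) :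
    ∃ h : L2, toDist h = smulLeftCLM ℂ (fun x => (g x : ℂ)) (toDist f) := by
  obtain ⟨C, hC⟩ := hg.exists_bound
  have hm : MemLp (fun x => (g x : ℂ)) ∞ (volume : Measure ℝ) :=
    memLp_top_of_bound hg.hasTemperateGrowth_ofReal.1.continuous.aestronglyMeasurable C
      (ae_of_all _ fun x => by simpa using hC x)
  exact ⟨hm.toLp _ • f, Lp.toTemperedDistribution_smul_eq hg.hasTemperateGrowth_ofReal hm f⟩

/-! ### Multiplication operators and elliptic regularity -/

/-- Multiplication of tempered distributions by a real function. -/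
noncomputable abbrev mulDist (g : ℝ → ℝ) : 𝓢'(ℝ, ℂ) →L[ℂ] 𝓢'(ℝ, ℂ) :=
  smulLeftCLM ℂ (fun x => (g x : ℂ))

namespace IsBddSmooth

variable {g h : ℝ → ℝ}

theorem derivCLM_mulDist (hg : IsBddSmooth g) (f : 𝓢'(ℝ, ℂ)) :
    derivCLM ℂ (mulDist g f) = mulDist (_root_.deriv g) f + mulDist g (derivCLM ℂ f) :=
  derivCLM_smulLeftCLM hg.hasTemperateGrowth_ofReal hg.deriv.hasTemperateGrowth_ofReal
    (fun x => (hg.hasDerivAt x).ofReal_comp) f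

theorem derivCLM_derivCLM_mulDist (hg : IsBddSmooth g) (f : 𝓢'(ℝ, ℂ)) :
    derivCLM ℂ (derivCLM ℂ (mulDist g f)) =
      mulDist (_root_.deriv (_root_.deriv g)) f + mulDist (_root_.deriv g) (derivCLM ℂ f) +
        (mulDist (_root_.deriv g) (derivCLM ℂ f) + mulDist g (derivCLM ℂ (derivCLM ℂ f))) := by
  rw [hg.derivCLM_mulDist, map_add, hg.deriv.derivCLM_mulDist, hg.derivCLM_mulDist]

theorem mulDist_mulDist_of_mul_eq_one (hg : IsBddSmooth g) (hh : IsBddSmooth h)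
    (hgh : ∀ x, g x * h x = 1) (f : 𝓢'(ℝ, ℂ)) : mulDist h (mulDist g f) = f := by
  rw [mulDist, smulLeftCLM_smulLeftCLM_apply hg.hasTemperateGrowth_ofReal
    hh.hasTemperateGrowth_ofReal]
  have : (fun x => (g x : ℂ)) * (fun x => (h x : ℂ)) = fun _ => 1 := by
    ext x
    simp [← Complex.ofReal_mul, hgh]
  rw [this, smulLeftCLM_const, one_smul]

theorem memSobolev_zero_mulDist (hg : IsBddSmooth g) {f : 𝓢'(ℝ, ℂ)} (hf : MemSobolev 0 2 f) :
    MemSobolev 0 2 (mulDist g f) := by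
  obtain ⟨f, rfl⟩ := memSobolev_zero_iff.1 hf
  obtain ⟨k, hk⟩ := exists_toDist_eq_smulLeftCLM hg f
  rw [toDist_apply f] at hk
  exact memSobolev_zero_iff.2 ⟨k, hk.symm⟩

theorem memSobolev_two_mulDist (hg : IsBddSmooth g) {f : 𝓢'(ℝ, ℂ)} (hf : MemSobolev 2 2 f) :
    MemSobolev 2 2 (mulDist g f) := by
  have h1 : MemSobolev 1 2 (derivCLM ℂ f) := memSobolev_derivCLM (by norm_num) hf
  have h2 : MemSobolev 0 2 (derivCLM ℂ (derivCLM ℂ f)) := memSobolev_derivCLM (by norm_num) h1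
  have h0 : MemSobolev 0 2 f := hf.mono (by norm_num)
  replace h1 : MemSobolev 0 2 (derivCLM ℂ f) := h1.mono (by norm_num)
  refine memSobolev_of_derivCLM_derivCLM (zero_add _) (hg.memSobolev_zero_mulDist h0) ?_
  rw [hg.derivCLM_derivCLM_mulDist]
  exact ((hg.deriv.deriv.memSobolev_zero_mulDist h0).add
    (hg.deriv.memSobolev_zero_mulDist h1)).add
    ((hg.deriv.memSobolev_zero_mulDist h1).add (hg.memSobolev_zero_mulDist h2))

theorem memSobolev_derivCLM_mulDist_derivCLM (hg : IsBddSmooth g) {f : 𝓢'(ℝ, ℂ)}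
    (hf : MemSobolev 2 2 f) : MemSobolev 0 2 (derivCLM ℂ (mulDist g (derivCLM ℂ f))) := by
  have h1 : MemSobolev 1 2 (derivCLM ℂ f) := memSobolev_derivCLM (by norm_num) hf
  have h2 : MemSobolev 0 2 (derivCLM ℂ (derivCLM ℂ f)) := memSobolev_derivCLM (by norm_num) h1
  rw [hg.derivCLM_mulDist]
  exact (hg.deriv.memSobolev_zero_mulDist (h1.mono (by norm_num))).add
    (hg.memSobolev_zero_mulDist h2)

/-- Commuting the inner derivative past `g` leaves only products with `L²` functions, so no
multiplier theorem on negative-order spaces is needed. -/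
theorem memSobolev_neg_two_derivCLM_mulDist_derivCLM (hg : IsBddSmooth g) {f : 𝓢'(ℝ, ℂ)}
    (hf : MemSobolev 0 2 f) : MemSobolev (-2) 2 (derivCLM ℂ (mulDist g (derivCLM ℂ f))) := by
  have h : mulDist g (derivCLM ℂ f) = derivCLM ℂ (mulDist g f) - mulDist (_root_.deriv g) f := by
    rw [hg.derivCLM_mulDist, add_sub_cancel_left]
  rw [h, map_sub]
  have h1 : MemSobolev (-1) 2 (derivCLM ℂ (mulDist g f)) :=
    memSobolev_derivCLM (by norm_num) (hg.memSobolev_zero_mulDist hf)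
  have h2 : MemSobolev (-1) 2 (derivCLM ℂ (mulDist (_root_.deriv g) f)) :=
    memSobolev_derivCLM (by norm_num) (hg.deriv.memSobolev_zero_mulDist hf)
  exact (memSobolev_derivCLM (by norm_num) h1).sub (h2.mono (by norm_num))

theorem memSobolev_neg_two_mulDist_derivCLM_derivCLM (hg : IsBddSmooth g) {f : 𝓢'(ℝ, ℂ)}
    (hf : MemSobolev 0 2 f) : MemSobolev (-2) 2 (mulDist g (derivCLM ℂ (derivCLM ℂ f))) := by
  have h : mulDist g (derivCLM ℂ (derivCLM ℂ f)) =
      derivCLM ℂ (mulDist g (derivCLM ℂ f)) - derivCLM ℂ (mulDist (_root_.deriv g) f) +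
        mulDist (_root_.deriv (_root_.deriv g)) f := by
    rw [hg.derivCLM_mulDist, hg.deriv.derivCLM_mulDist]
    abel
  rw [h]
  have h1 : MemSobolev (-1) 2 (derivCLM ℂ (mulDist (_root_.deriv g) f)) :=
    memSobolev_derivCLM (by norm_num) (hg.deriv.memSobolev_zero_mulDist hf)
  exact ((hg.memSobolev_neg_two_derivCLM_mulDist_derivCLM hf).sub (h1.mono (by norm_num))).add
    ((hg.deriv.deriv.memSobolev_zero_mulDist hf).mono (by norm_num))

/-- Elliptic regularity for `∂² g ∂² + ∂ V ∂`, where `g` is invertible. -/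
theorem memSobolev_four_of_elliptic {V : ℝ → ℝ} (hg : IsBddSmooth g) (hh : IsBddSmooth h)
    (hgh : ∀ x, g x * h x = 1) (hV : IsBddSmooth V) {f : 𝓢'(ℝ, ℂ)} (hf : MemSobolev 0 2 f)
    (hL : MemSobolev 0 2 (derivCLM ℂ (derivCLM ℂ (mulDist g (derivCLM ℂ (derivCLM ℂ f)))) +
      derivCLM ℂ (mulDist V (derivCLM ℂ f)))) : MemSobolev 4 2 f := by
  set w := mulDist g (derivCLM ℂ (derivCLM ℂ f)) with hw
  have hfw : mulDist h w = derivCLM ℂ (derivCLM ℂ f) := hg.mulDist_mulDist_of_mul_eq_one hh hgh _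
  -- A priori `w` is only in `H⁻²`, but so is `w''`, which raises `w` to `L²`. Dividing by `g` then
  -- puts `f` in `H²`; this improves `w''` to `L²`, and a second round gives `H⁴`.
  have hw0 : MemSobolev 0 2 w := by
    refine memSobolev_of_derivCLM_derivCLM (by norm_num)
      (hg.memSobolev_neg_two_mulDist_derivCLM_derivCLM hf) ?_
    simpa using (hL.mono (s' := -2) (by norm_num)).sub
      (hV.memSobolev_neg_two_derivCLM_mulDist_derivCLM hf)
  have hf2 : MemSobolev 2 2 f := memSobolev_of_derivCLM_derivCLM (zero_add _) hf
    (hfw ▸ hh.memSobolev_zero_mulDist hw0)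
  have hw2 : MemSobolev 2 2 w := by
    refine memSobolev_of_derivCLM_derivCLM (zero_add _) hw0 ?_
    simpa using hL.sub (hV.memSobolev_derivCLM_mulDist_derivCLM hf2)
  exact memSobolev_of_derivCLM_derivCLM (by norm_num) hf2 (hfw ▸ hh.memSobolev_two_mulDist hw2)

end IsBddSmooth

/-! ### Mapping properties and domain of the operator -/

theorem distL_eq (κ c : ℝ) (Q : ℝ → ℝ) (f : 𝓢'(ℝ, ℂ)) :
    distL κ c Q f =
      -(derivCLM ℂ (derivCLM ℂ (mulDist (fun x => Q x - c) (derivCLM ℂ (derivCLM ℂ f)))) +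
        derivCLM ℂ (mulDist (fun x => iteratedDeriv 2 Q x - 3 * Q x + c - 2 * κ)
          (derivCLM ℂ f))) := by
  simp only [distL, distM, neg_apply, ContinuousLinearMap.comp_apply,
    add_apply, map_add]

namespace IsSolitaryWave

variable {κ c : ℝ} {Q : ℝ → ℝ}

theorem memSobolev_zero_distL (hQ : IsSolitaryWave κ c Q) (hκ : 0 < κ) (hc0 : 0 < c)
    {f : 𝓢'(ℝ, ℂ)} (hf : MemSobolev 4 2 f) : MemSobolev 0 2 (distL κ c Q f) := by
  obtain ⟨hg, -, hV⟩ := hQ.isBddSmooth_coefficients hκ hc0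
  have h1 : MemSobolev 3 2 (derivCLM ℂ f) := memSobolev_derivCLM (by norm_num) hf
  have h2 : MemSobolev 2 2 (derivCLM ℂ (derivCLM ℂ f)) := memSobolev_derivCLM (by norm_num) h1
  have h3 := memSobolev_derivCLM (t := 1) (by norm_num) (hg.memSobolev_two_mulDist h2)
  rw [distL_eq]
  exact ((memSobolev_derivCLM (by norm_num) h3).add
    (hV.memSobolev_derivCLM_mulDist_derivCLM (hf.mono (by norm_num)))).neg

theorem memSobolev_four_of_distL (hQ : IsSolitaryWave κ c Q) (hκ : 0 < κ) (hc0 : 0 < c)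
    {f : 𝓢'(ℝ, ℂ)} (hf : MemSobolev 0 2 f) (hL : MemSobolev 0 2 (distL κ c Q f)) :
    MemSobolev 4 2 f := by
  obtain ⟨hg, hh, hV⟩ := hQ.isBddSmooth_coefficients hκ hc0
  refine hg.memSobolev_four_of_elliptic hh
    (fun x => mul_inv_cancel₀ (sub_neg.2 (hQ.lt_speed hκ hc0 x)).ne) hV hf ?_
  rw [distL_eq] at hL
  simpa using hL.neg

theorem opL_domain_eq (hQ : IsSolitaryWave κ c Q) (hκ : 0 < κ) (hc0 : 0 < c) :
    (opL κ c Q).domain = H4 := by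
  ext f
  rw [mem_opL_domain_iff, and_iff_left_iff_imp]
  intro hf
  obtain ⟨g, hg⟩ := memSobolev_zero_iff.1 (hQ.memSobolev_zero_distL hκ hc0 hf)
  exact ⟨g, hg.symm⟩

end IsSolitaryWave

/-! ### Symmetry of the building blocks -/

/-- Integration by parts for `L²` functions with weak derivatives in `L²`. -/
theorem inner_derivCLM_left {f f' g g' : L2} (hf : toDist f' = derivCLM ℂ (toDist f))
    (hg : toDist g' = derivCLM ℂ (toDist g)) : inner ℂ f' g = -inner ℂ f g' := by
  -- By Plancherel, differentiation becomes multiplication by `2πix`; the symbol is purely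
  -- imaginary, hence the minus sign.
  have key {f f' : L2} (hf : toDist f' = derivCLM ℂ (toDist f)) :
      (𝓕 f' : L2) =ᵐ[volume] fun x => (2 * Real.pi * Complex.I * x) * (𝓕 f : L2) x := by
    refine ae_eq_mul_of_toDist_eq (by fun_prop) ?_
    rw [toDist_apply, toDist_apply, ← Lp.fourier_toTemperedDistribution_eq,
      ← Lp.fourier_toTemperedDistribution_eq, ← toDist_apply, hf, ← lineDerivOp_one_eq_derivCLM,
      fourier_lineDerivOp_eq]
    have : (fun x : ℝ => 2 * Real.pi * Complex.I * (x : ℂ)) =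
        (2 * Real.pi * Complex.I) • fun x : ℝ => (x : ℂ) := by
      ext x; simp
    rw [this, smulLeftCLM_smul (by fun_prop)]
    simp [toDist_apply]
  rw [← Lp.inner_fourier_eq f' g, ← Lp.inner_fourier_eq f g', L2.inner_def, L2.inner_def,
    ← integral_neg]
  refine integral_congr_ae ?_
  filter_upwards [key hf, key hg] with x hx hx'
  simp only [hx, hx', RCLike.inner_apply, map_mul, Complex.conj_I, Complex.conj_ofReal, map_ofNat]
  ring

theorem inner_mulDist_left {a : ℝ → ℝ} (ha : IsBddSmooth a) {f f' g g' : L2}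
    (hf : toDist f' = mulDist a (toDist f)) (hg : toDist g' = mulDist a (toDist g)) :
    inner ℂ f' g = inner ℂ f g' := by
  rw [L2.inner_def, L2.inner_def]
  refine integral_congr_ae ?_
  filter_upwards [ae_eq_mul_of_toDist_eq ha.hasTemperateGrowth_ofReal hf,
    ae_eq_mul_of_toDist_eq ha.hasTemperateGrowth_ofReal hg] with x hx hx'
  simp only [hx, hx', RCLike.inner_apply, map_mul, Complex.conj_ofReal]
  ring

/-! ### Schwartz test functions and conjugation -/

/-- `-∂ₓ M ∂ₓ` acting on Schwartz functions. -/
noncomputable def schwartzL (κ c : ℝ) (Q : ℝ → ℝ) : 𝓢(ℝ, ℂ) →L[ℂ] 𝓢(ℝ, ℂ) :=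
  -(SchwartzMap.derivCLM ℂ ℂ ∘L
    (SchwartzMap.derivCLM ℂ ℂ ∘L SchwartzMap.smulLeftCLM ℂ (fun x => ((Q x - c : ℝ) : ℂ)) ∘L
        SchwartzMap.derivCLM ℂ ℂ +
      SchwartzMap.smulLeftCLM ℂ
        (fun x => ((iteratedDeriv 2 Q x - 3 * Q x + c - 2 * κ : ℝ) : ℂ))) ∘L
    SchwartzMap.derivCLM ℂ ℂ)

/-- Complex conjugation of Schwartz functions. -/
noncomputable def schwartzConj : 𝓢(ℝ, ℂ) →L[ℝ] 𝓢(ℝ, ℂ) :=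
  SchwartzMap.postcompCLM (Complex.conjCLE : ℂ →L[ℝ] ℂ)

@[simp]
theorem schwartzConj_apply (u : 𝓢(ℝ, ℂ)) (x : ℝ) :
    schwartzConj u x = starRingEnd ℂ (u x) := rfl

theorem derivCLM_schwartzConj (u : 𝓢(ℝ, ℂ)) :
    SchwartzMap.derivCLM ℂ ℂ (schwartzConj u) = schwartzConj (SchwartzMap.derivCLM ℂ ℂ u) := by
  ext x
  exact (u.hasDerivAt x).star.deriv

theorem smulLeftCLM_schwartzConj {g : ℝ → ℝ} (hg : (fun x => (g x : ℂ)).HasTemperateGrowth)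
    (u : 𝓢(ℝ, ℂ)) : SchwartzMap.smulLeftCLM ℂ (fun x => (g x : ℂ)) (schwartzConj u) =
      schwartzConj (SchwartzMap.smulLeftCLM ℂ (fun x => (g x : ℂ)) u) := by
  ext x
  simp [hg]

theorem smulLeftCLM_coe_schwartz {g : ℝ → ℂ} (hg : g.HasTemperateGrowth) (u : 𝓢(ℝ, ℂ)) :
    smulLeftCLM ℂ g (u : 𝓢'(ℝ, ℂ)) = (SchwartzMap.smulLeftCLM ℂ g u : 𝓢(ℝ, ℂ)) := by
  ext v
  simp [hg, mul_assoc, mul_left_comm]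

/-- Each term contains an even number of derivatives, arranged symmetrically around its coefficient,
so the transpose is the same expression. -/
theorem distL_apply_apply (κ c : ℝ) (Q : ℝ → ℝ) (f : 𝓢'(ℝ, ℂ)) (u : 𝓢(ℝ, ℂ)) :
    distL κ c Q f u = f (schwartzL κ c Q u) := by
  simp [distL, distM, schwartzL]

theorem toDist_opL (κ c : ℝ) (Q : ℝ → ℝ) (ψ : (opL κ c Q).domain) :
    toDist (opL κ c Q ψ) = distL κ c Q (toDist ψ) :=
  opL_apply κ c Q ψ

theorem toDist_toLp (u : 𝓢(ℝ, ℂ)) :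
    toDist (u.toLp 2) = SchwartzMap.toTemperedDistributionCLM ℝ ℂ volume u := by
  rw [toDist_apply, Lp.toTemperedDistribution_toLp_eq]

/-- The distributional pairing is bilinear while the inner product is conjugate-linear in its first
slot, hence the conjugate. -/
theorem toDist_apply_eq_inner (f : L2) (u : 𝓢(ℝ, ℂ)) :
    toDist f u = inner ℂ ((schwartzConj u).toLp 2 : L2) f := by
  rw [toDist_apply, Lp.toTemperedDistribution_apply, L2.inner_def]
  refine integral_congr_ae ?_
  filter_upwards [(schwartzConj u).coeFn_toLp 2 volume] with x hx
  simp [hx, mul_comm]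

theorem toLp_mem_H4 (u : 𝓢(ℝ, ℂ)) : (u.toLp 2 : L2) ∈ H4 := by
  rw [mem_H4_iff, ← toDist_apply, toDist_toLp]
  exact u.memSobolev

theorem dense_H4 : Dense (H4 : Set L2) :=
  (SchwartzMap.denseRange_toLpCLM (p := 2) ENNReal.ofNat_ne_top).mono
    (Set.range_subset_iff.2 toLp_mem_H4)

theorem MemSobolev.exists_toDist {s : ℝ} (hs : 0 ≤ s) {f : 𝓢'(ℝ, ℂ)} (hf : MemSobolev s 2 f) :
    ∃ g : L2, toDist g = f :=
  (memSobolev_zero_iff.1 (hf.mono hs)).imp fun _ h => h.symm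

/-! ### Self-adjointness -/

namespace IsSolitaryWave

variable {κ c : ℝ} {Q : ℝ → ℝ}

theorem distL_coe_schwartz (hQ : IsSolitaryWave κ c Q) (hκ : 0 < κ) (hc0 : 0 < c) (u : 𝓢(ℝ, ℂ)) :
    distL κ c Q (u : 𝓢'(ℝ, ℂ)) = (schwartzL κ c Q u : 𝓢(ℝ, ℂ)) := by
  obtain ⟨hg, -, hV⟩ := hQ.isBddSmooth_coefficients hκ hc0
  simp only [distL, distM, schwartzL, neg_apply, add_apply, ContinuousLinearMap.comp_apply,
    derivCLM_toTemperedDistributionCLM_eq ℂ, map_neg, map_add,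
    smulLeftCLM_coe_schwartz hg.hasTemperateGrowth_ofReal,
    smulLeftCLM_coe_schwartz hV.hasTemperateGrowth_ofReal]

/-- The coefficients are real. -/
theorem schwartzL_schwartzConj (hQ : IsSolitaryWave κ c Q) (hκ : 0 < κ) (hc0 : 0 < c)
    (u : 𝓢(ℝ, ℂ)) : schwartzL κ c Q (schwartzConj u) = schwartzConj (schwartzL κ c Q u) := by
  obtain ⟨hg, -, hV⟩ := hQ.isBddSmooth_coefficients hκ hc0
  simp only [schwartzL, neg_apply, add_apply, ContinuousLinearMap.comp_apply,
    derivCLM_schwartzConj, map_neg, map_add,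
    smulLeftCLM_schwartzConj hg.hasTemperateGrowth_ofReal,
    smulLeftCLM_schwartzConj hV.hasTemperateGrowth_ofReal]

theorem opL_toLp (hQ : IsSolitaryWave κ c Q) (hκ : 0 < κ) (hc0 : 0 < c) (u : 𝓢(ℝ, ℂ))
    (ψ : (opL κ c Q).domain) (hψ : (ψ : L2) = u.toLp 2) :
    opL κ c Q ψ = (schwartzL κ c Q u).toLp 2 := by
  apply toDist_injective
  rw [toDist_opL, hψ, toDist_toLp, toDist_toLp, hQ.distL_coe_schwartz hκ hc0]

/-- Weak form of the operator: moving two derivatives onto the second argument. -/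
theorem exists_inner_opL (hQ : IsSolitaryWave κ c Q) (hκ : 0 < κ) (hc0 : 0 < c)
    (f : (opL κ c Q).domain) : ∃ f₁ f₂ p v : L2,
      toDist f₁ = derivCLM ℂ (toDist f) ∧ toDist f₂ = derivCLM ℂ (toDist f₁) ∧
      toDist p = mulDist (fun x => Q x - c) (toDist f₂) ∧
      toDist v = mulDist (fun x => iteratedDeriv 2 Q x - 3 * Q x + c - 2 * κ) (toDist f₁) ∧
      ∀ g g₁ g₂ : L2, toDist g₁ = derivCLM ℂ (toDist g) → toDist g₂ = derivCLM ℂ (toDist g₁) →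
        inner ℂ (opL κ c Q f) g = inner ℂ v g₁ - inner ℂ p g₂ := by
  obtain ⟨hg, -, hV⟩ := hQ.isBddSmooth_coefficients hκ hc0
  have hf : MemSobolev 4 2 (toDist f) := (hQ.opL_domain_eq hκ hc0).le f.2
  have h1 : MemSobolev 3 2 (derivCLM ℂ (toDist f)) := memSobolev_derivCLM (by norm_num) hf
  obtain ⟨f₁, hf₁⟩ := MemSobolev.exists_toDist (by norm_num) h1
  rw [← hf₁] at h1
  have h2 : MemSobolev 2 2 (derivCLM ℂ (toDist f₁)) := memSobolev_derivCLM (by norm_num) h1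
  obtain ⟨f₂, hf₂⟩ := MemSobolev.exists_toDist (by norm_num) h2
  rw [← hf₂] at h2
  have hp := hg.memSobolev_two_mulDist h2
  obtain ⟨p, hp'⟩ := MemSobolev.exists_toDist (by norm_num) hp
  rw [← hp'] at hp
  have hp1 : MemSobolev 1 2 (derivCLM ℂ (toDist p)) := memSobolev_derivCLM (by norm_num) hp
  obtain ⟨p₁, hp₁⟩ := MemSobolev.exists_toDist (by norm_num) hp1
  rw [← hp₁] at hp1
  obtain ⟨p₂, hp₂⟩ := MemSobolev.exists_toDist le_rfl
    (memSobolev_derivCLM (t := 0) (by norm_num) hp1)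
  obtain ⟨v, hv⟩ := exists_toDist_eq_smulLeftCLM hV f₁
  obtain ⟨v₁, hv₁⟩ := MemSobolev.exists_toDist le_rfl
    (hV.memSobolev_derivCLM_mulDist_derivCLM (hf.mono (by norm_num)))
  rw [← hf₁, mulDist, ← hv] at hv₁
  refine ⟨f₁, f₂, p, v, hf₁, hf₂, hp', hv, fun g g₁ g₂ hg₁ hg₂ => ?_⟩
  -- Here `p₂ = p''` and `v₁ = v'`: two integrations by parts on the first and one on the second
  -- give the weak form.
  have hLf : opL κ c Q f = -(p₂ + v₁) := by
    apply toDist_injective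
    rw [toDist_opL, distL_eq, map_neg, map_add, hp₂, hp₁, hp', hf₂,
      hf₁, hv₁, hv, hf₁]
  rw [hLf, inner_neg_left, inner_add_left, inner_derivCLM_left hp₂ hg₁, inner_derivCLM_left hp₁ hg₂,
    inner_derivCLM_left hv₁ hg₁]
  ring

/-- In the weak form both terms are symmetric in `f` and `g`, because multiplication by a real
function is symmetric. -/
theorem opL_isFormalAdjoint (hQ : IsSolitaryWave κ c Q) (hκ : 0 < κ) (hc0 : 0 < c) :
    (opL κ c Q).IsFormalAdjoint (opL κ c Q) := by
  intro f g
  obtain ⟨ha, -, hV⟩ := hQ.isBddSmooth_coefficients hκ hc0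
  obtain ⟨f₁, f₂, p, v, hf₁, hf₂, hp, hv, hf⟩ := hQ.exists_inner_opL hκ hc0 f
  obtain ⟨g₁, g₂, q, w, hg₁, hg₂, hq, hw, hg⟩ := hQ.exists_inner_opL hκ hc0 g
  rw [hf g g₁ g₂ hg₁ hg₂, ← inner_conj_symm (f : L2), hg f f₁ f₂ hf₁ hf₂, map_sub, inner_conj_symm,
    inner_conj_symm, inner_mulDist_left hV hv hw, inner_mulDist_left ha hp hq]

theorem dense_opL_domain (hQ : IsSolitaryWave κ c Q) (hκ : 0 < κ) (hc0 : 0 < c) :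
    Dense ((opL κ c Q).domain : Set L2) := by
  rw [hQ.opL_domain_eq hκ hc0]
  exact dense_H4

theorem adjoint_opL_domain_le (hQ : IsSolitaryWave κ c Q) (hκ : 0 < κ) (hc0 : 0 < c) :
    (opL κ c Q).adjoint.domain ≤ H4 := by
  intro y hy
  set w := (opL κ c Q).adjoint ⟨y, hy⟩ with hw
  -- The adjoint relation against conjugated Schwartz functions says exactly that `L y = w` as
  -- distributions.
  have key : distL κ c Q (toDist y) = toDist w := by
    ext u
    have hu : ((schwartzConj u).toLp 2 : L2) ∈ (opL κ c Q).domain := by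
      rw [hQ.opL_domain_eq hκ hc0]
      exact toLp_mem_H4 _
    have h := LinearPMap.adjoint_isFormalAdjoint (hQ.dense_opL_domain hκ hc0) ⟨y, hy⟩ ⟨_, hu⟩
    rw [distL_apply_apply, toDist_apply_eq_inner, toDist_apply_eq_inner,
      ← hQ.schwartzL_schwartzConj hκ hc0, ← hQ.opL_toLp hκ hc0 _ ⟨_, hu⟩ rfl, ← inner_conj_symm, ← h,
      inner_conj_symm]
  exact hQ.memSobolev_four_of_distL hκ hc0 (memSobolev_zero_toDist y)
    (key ▸ memSobolev_zero_toDist w)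

theorem isSelfAdjoint_opL (hQ : IsSolitaryWave κ c Q) (hκ : 0 < κ) (hc0 : 0 < c) :
    IsSelfAdjoint (opL κ c Q) := by
  rw [LinearPMap.isSelfAdjoint_def]
  refine (LinearPMap.eq_of_le_of_domain_eq ((hQ.opL_isFormalAdjoint hκ hc0).le_adjoint
    (hQ.dense_opL_domain hκ hc0)) (le_antisymm ?_ ?_)).symm
  · exact ((hQ.opL_isFormalAdjoint hκ hc0).le_adjoint (hQ.dense_opL_domain hκ hc0)).1
  · rw [hQ.opL_domain_eq hκ hc0]
    exact hQ.adjoint_opL_domain_le hκ hc0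

end IsSolitaryWave

end CHKP

theorem mainTheorem5 (κ c : ℝ) (hκ : 0 < κ) (hc : 2 * κ < c) (Q : ℝ → ℝ)
    (hQ : CHKP.IsSolitaryWave κ c Q) :
    (CHKP.opL κ c Q).domain = CHKP.H4 ∧
      IsSelfAdjoint (CHKP.opL κ c Q) ∧
      (CHKP.opL κ c Q).adjoint.domain = CHKP.H4 := by
  have hc0 : 0 < c := by linarith
  have hd := hQ.opL_domain_eq hκ hc0
  have hs := hQ.isSelfAdjoint_opL hκ hc0
  exact ⟨hd, hs, by rw [LinearPMap.isSelfAdjoint_def.1 hs, hd]⟩
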